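/- Let $n,p,k$ be non-negative integers, let $\mathcal P_{n,k}$ be the set of $n\times n$ permutation matrices $\Pi$ with $d(\Pi,I_n):=\#\{i:\Pi_{ii}=0\}\le k$, let $X\in\mathbb R^{n\times p}$ be a fixed matrix of full column rank $p$, and let $\beta_0\in\mathbb R^p$, $\sigma_0>0$ and $\Pi_0\in\mathcal P_{n,k}$. The data are $Y=\Pi_0X\beta_0+\sigma_0U$, and $U,U_1^*,\dots,U_L^*$ are independent $\mathrm N(0,I_n)$ vectors. For $\ell=1,\dots,L$ let $$\hat\Pi_\ell\in\operatorname*{arg\,min}_{\Pi\in\mathcal P_{n,k}}\big\|(I_n-M_{(\Pi X,\,U_\ell^*)})Y\big\|_2^2$$ with ties broken in an arbitrary way, where $M_A$ is the orthogonal projection onto the range of $A$, and let $\mathcal C^{(L)}=\{\hat\Pi_1,\dots,\hat\Pi_L\}$. Put $$C_{\min}(\Pi_0)=\min_{\Pi\in\mathcal P_{n,k},\ \Pi\ne\Pi_0}\frac{\|(I_n-\Pi M_X\Pi^\top)\Pi_0X\beta_0\|_2^2}{n\max(d(\Pi_0,I_n)-d(\Pi,I_n),1)},\qquad M_X=X(X^\top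 X)^{-1}X^\top,$$ where the minimum over the empty set is $+\infty$. Theorem. Suppose that $C_{\min}(\Pi_0)>0$ and $n>p+1$. Then there is a sequence $(\delta_L)_{L\in\mathbb N}$ of positive real numbers, which may depend on $n,p,k,X,\beta_0,\sigma_0,\Pi_0$ but not on how ties are broken, such that $$\mathbb P_{(U_1^*,\dots,U_L^*,U)}\big(\Pi_0\notin\mathcal C^{(L)}\big)\le\delta_L\qquad\text{for all }L\ge2,$$ and, as $L\to\infty$, $$\delta_L=O\!\left(\frac{(\log L)^{(n-p)/2}}{L^{(n-p-1)/(2(n-1))}}\right).$$ -/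

import Mathlib

open MeasureTheory ProbabilityTheory Filter Asymptotics

noncomputable section

namespace PermReg

/-- The number of mismatches of a matrix `Q`: the number of indices `i` with `Q i i = 0`.
For a permutation matrix this is its Hamming distance `d(Q, I)` to the identity. -/
def mismatch {n : ℕ} (Q : Matrix (Fin n) (Fin n) ℝ) : ℕ :=
  {i : Fin n | Q i i = 0}.ncard

/-- The set of `k`-sparse `n × n` permutation matrices. -/
def sparsePerms (n k : ℕ) : Set (Matrix (Fin n) (Fin n) ℝ) :=
  {Q | (∃ τ : Equiv.Perm (Fin n), Q = τ.permMatrix ℝ) ∧ mismatch Q ≤ k}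

/-- The matrix `M_X = X (Xᵀ X)⁻¹ Xᵀ`. -/
def hatMatrix {n p : ℕ} (X : Matrix (Fin n) (Fin p) ℝ) : Matrix (Fin n) (Fin n) ℝ :=
  X * (X.transpose * X)⁻¹ * X.transpose

/-- The ratio minimised in the separation constant:
`‖(I - Q M_X Qᵀ) Q₀ X β₀‖² / (n max (d(Q₀, I) - d(Q, I), 1))`. -/
def sepRatio {n p : ℕ} (X : Matrix (Fin n) (Fin p) ℝ) (β₀ : Fin p → ℝ)
    (Q₀ Q : Matrix (Fin n) (Fin n) ℝ) : ℝ :=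
  ‖WithLp.toLp 2 ((1 - Q * hatMatrix X * Q.transpose).mulVec ((Q₀ * X).mulVec β₀))‖ ^ 2 /
    ((n : ℝ) * max ((mismatch Q₀ : ℝ) - (mismatch Q : ℝ)) 1)

/-- The separation constant: the minimum of `sepRatio` over the `k`-sparse permutation matrices
other than `Q₀`. It is taken in the extended reals, so that it is `+∞` if there are none. -/
def Cmin {n p : ℕ} (k : ℕ) (X : Matrix (Fin n) (Fin p) ℝ) (β₀ : Fin p → ℝ)
    (Q₀ : Matrix (Fin n) (Fin n) ℝ) : EReal :=
  ⨅ Q ∈ {Q | Q ∈ sparsePerms n k ∧ Q ≠ Q₀}, ((sepRatio X β₀ Q₀ Q : ℝ) : EReal)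

/-- The column space (range) of a matrix, as a subspace of Euclidean space. -/
def colSpace {n : ℕ} {ι : Type*} (A : Matrix (Fin n) ι ℝ) :
    Submodule ℝ (EuclideanSpace ℝ (Fin n)) :=
  Submodule.span ℝ (Set.range fun j : ι => WithLp.toLp 2 (fun i => A i j))

/-- The matrix `(Q X, u)`: the columns of `Q X`, followed by the column `u`. -/
def augDesign {n p : ℕ} (X : Matrix (Fin n) (Fin p) ℝ) (u : EuclideanSpace ℝ (Fin n))
    (Q : Matrix (Fin n) (Fin n) ℝ) : Matrix (Fin n) (Fin p ⊕ Unit) ℝ :=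
  Matrix.fromCols (Q * X) (Matrix.replicateCol Unit (fun i => u i))

/-- The least squares objective `‖(I - M_{(Q X, u)}) y‖²`, where `M_A` is the orthogonal
projection onto the range of `A`. -/
def objective {n p : ℕ} (X : Matrix (Fin n) (Fin p) ℝ) (y u : EuclideanSpace ℝ (Fin n))
    (Q : Matrix (Fin n) (Fin n) ℝ) : ℝ :=
  ‖y - (colSpace (augDesign X u Q)).starProjection y‖ ^ 2

/-- The set of minimisers of the objective over the `k`-sparse permutation matrices. -/
def argminSet {n p : ℕ} (k : ℕ) (X : Matrix (Fin n) (Fin p) ℝ)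
    (y u : EuclideanSpace ℝ (Fin n)) : Set (Matrix (Fin n) (Fin n) ℝ) :=
  {Q | Q ∈ sparsePerms n k ∧ ∀ Q' ∈ sparsePerms n k, objective X y u Q ≤ objective X y u Q'}

/-- The response `Y = Q₀ X β₀ + σ₀ u`. -/
def response {n p : ℕ} (X : Matrix (Fin n) (Fin p) ℝ) (β₀ : Fin p → ℝ) (σ₀ : ℝ)
    (Q₀ : Matrix (Fin n) (Fin n) ℝ) (u : EuclideanSpace ℝ (Fin n)) : EuclideanSpace ℝ (Fin n) :=
  WithLp.toLp 2 ((Q₀ * X).mulVec β₀) + σ₀ • u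

/-- Sample points: the `L` artificial noise vectors together with the noise of the data. -/
abbrev Sample (n L : ℕ) : Type :=
  (Fin L → EuclideanSpace ℝ (Fin n)) × EuclideanSpace ℝ (Fin n)

/-- The joint law of the `L` artificial noise vectors and the noise of the data:
all of them are independent and standard Gaussian. -/
def jointLaw (n L : ℕ) : Measure (Sample n L) :=
  (Measure.pi fun _ : Fin L => stdGaussian (EuclideanSpace ℝ (Fin n))).prod
    (stdGaussian (EuclideanSpace ℝ (Fin n)))

/-- `Qhat` is a version of the repro-sample estimators: for each sample point `ω` and each `ℓ`,
`Qhat ω ℓ` is a minimiser of the objective with the data `Y` and the artificial noise `ω.1 ℓ`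
(ties may be broken in any way). -/
def IsReproEstimator {n p L : ℕ} (k : ℕ) (X : Matrix (Fin n) (Fin p) ℝ) (β₀ : Fin p → ℝ) (σ₀ : ℝ)
    (Q₀ : Matrix (Fin n) (Fin n) ℝ)
    (Qhat : Sample n L → Fin L → Matrix (Fin n) (Fin n) ℝ) : Prop :=
  ∀ ω ℓ, Qhat ω ℓ ∈ argminSet k X (response X β₀ σ₀ Q₀ ω.2) (ω.1 ℓ)

/-- The candidate set: the collection of the `L` estimated permutation matrices. -/
def candidateSet {n L : ℕ} (Qhat : Sample n L → Fin L → Matrix (Fin n) (Fin n) ℝ)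
    (ω : Sample n L) : Set (Matrix (Fin n) (Fin n) ℝ) :=
  Set.range (Qhat ω)

end PermReg

end

open scoped RealInnerProductSpace ENNReal

/-! Write `μ = Q₀Xβ₀`. If some artificial noise `u` lies within `ε` of `U / ‖U‖`, then adjoining `u`
to the true design explains almost all the noise: the residual is at most `σ₀ε‖U‖`. A rival `Q` has
`μ` at distance `κ > 0` from `V = col(QX)`. It can compete only if a multiple of `u` also makes up
for the missing part of `μ`, which fails once `U` has a large enough component along a unit vector
orthogonal to `V` and `μ` (`lt_norm_sub_of_abs_inner_gt`).

There are `n - p - 1` such orthonormal directions, so on `‖U‖ ≤ R` failure costs `O((εR²)^(n-p-1))`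
(`exists_objective_lt`). That no `u` is close costs `exp(-cεⁿL)`
(`jointLaw_forall_notMem_closedBall_le`), and `‖U‖ > R` costs `M/R^q` for any chosen `q`. With `ε`,
`R` powers of `L` such that `εR² = L^(-1/(2(n-1)))`, the sum is `O(L^(-s))`, where `s` is the stated
exponent; the logarithm is slack. -/

/-! ### Gaussian estimates: slabs, small balls, tails -/

lemma gaussianReal_Icc_neg_le (t : ℝ) :
    gaussianReal 0 1 (Set.Icc (-t) t) ≤ ENNReal.ofReal t := by
  have hpdf : ∀ x : ℝ, gaussianPDF 0 1 x ≤ ENNReal.ofReal (1 / 2) := by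
    intro x
    rw [gaussianPDF_def]
    apply ENNReal.ofReal_le_ofReal
    rw [gaussianPDFReal_def]
    have h1 : Real.exp (-(x - 0) ^ 2 / (2 * ((1 : NNReal) : ℝ))) ≤ 1 := by
      rw [Real.exp_le_one_iff]
      have := sq_nonneg (x - 0)
      simp only [NNReal.coe_one]
      linarith
    have h2 : (2 : ℝ) ≤ √(2 * Real.pi * ((1 : NNReal) : ℝ)) := by
      apply Real.le_sqrt_of_sq_le
      have := Real.pi_gt_three
      simp only [NNReal.coe_one]
      linarith
    have h3 : (√(2 * Real.pi * ((1 : NNReal) : ℝ)))⁻¹ ≤ 1 / 2 := by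
      rw [one_div]; exact inv_anti₀ (by norm_num) h2
    calc _ ≤ (1 / 2 : ℝ) * 1 := mul_le_mul h3 h1 (Real.exp_pos _).le (by norm_num)
      _ = _ := by ring
  rw [gaussianReal_apply 0 one_ne_zero]
  calc ∫⁻ x in Set.Icc (-t) t, gaussianPDF 0 1 x
      ≤ ∫⁻ _ in Set.Icc (-t) t, ENNReal.ofReal (1 / 2) := lintegral_mono fun x => hpdf x
    _ = ENNReal.ofReal (1 / 2) * ENNReal.ofReal (t - -t) := by
        rw [setLIntegral_const, Real.volume_Icc]
    _ = ENNReal.ofReal t := by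
        rw [← ENNReal.ofReal_mul (by norm_num)]
        congr 1; ring

lemma le_gaussianReal_Icc {v ε : ℝ} (hv : |v| ≤ 1) (hε1 : ε ≤ 1) :
    ENNReal.ofReal (2 * gaussianPDFReal 0 1 2 * ε) ≤
      gaussianReal 0 1 (Set.Icc (v - ε) (v + ε)) := by
  rw [gaussianReal_apply 0 one_ne_zero]
  have hpdf : ∀ x ∈ Set.Icc (v - ε) (v + ε),
      ENNReal.ofReal (gaussianPDFReal 0 1 2) ≤ gaussianPDF 0 1 x := by
    intro x hx
    rw [gaussianPDF_def]
    apply ENNReal.ofReal_le_ofReal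
    rw [gaussianPDFReal_def]
    have hx2 : x ^ 2 ≤ 2 ^ 2 := by
      rw [abs_le] at hv
      apply sq_le_sq'
      · linarith [hx.1]
      · linarith [hx.2]
    simp only [NNReal.coe_one, sub_zero]
    refine mul_le_mul_of_nonneg_left (Real.exp_le_exp.2 ?_) (by positivity)
    linarith
  calc ENNReal.ofReal (2 * gaussianPDFReal 0 1 2 * ε)
      = ENNReal.ofReal (gaussianPDFReal 0 1 2) * ENNReal.ofReal (v + ε - (v - ε)) := by
        rw [← ENNReal.ofReal_mul (gaussianPDFReal_nonneg _ _ _)]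
        congr 1; ring
    _ = ∫⁻ _ in Set.Icc (v - ε) (v + ε), ENNReal.ofReal (gaussianPDFReal 0 1 2) := by
        rw [setLIntegral_const, Real.volume_Icc]
    _ ≤ _ := setLIntegral_mono' measurableSet_Icc hpdf

section

variable {E : Type*} [NormedAddCommGroup E] [InnerProductSpace ℝ E] [FiniteDimensional ℝ E]

lemma exists_orthonormalBasis_mem_submodule (W : Submodule ℝ E) {n m : ℕ}
    (hn : Module.finrank ℝ E = n) (hm : m ≤ Module.finrank ℝ W) :
    ∃ b : OrthonormalBasis (Fin n) ℝ E, ∃ S : Finset (Fin n), S.card = m ∧ ∀ i ∈ S, b i ∈ W := by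
  have hmn : m ≤ n := hm.trans (hn ▸ W.finrank_le)
  let e : Fin m → E := fun i => stdOrthonormalBasis ℝ W (Fin.castLE hm i)
  have he : Orthonormal ℝ e :=
    ((stdOrthonormalBasis ℝ W).orthonormal.comp_linearIsometry W.subtypeₗᵢ).comp _
      (Fin.castLE_injective hm)
  let v : Fin n → E := fun i => if h : (i : ℕ) < m then e ⟨i, h⟩ else 0
  let s : Set (Fin n) := {i | (i : ℕ) < m}
  have hv : Orthonormal ℝ (s.domRestrict v) := by
    have h : s.domRestrict v = e ∘ fun i : s => ⟨(i : Fin n), i.2⟩ := by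
      ext1 i
      have hi : ((i : Fin n) : ℕ) < m := i.2
      simp [v, hi, Set.domRestrict_apply]
    rw [h]
    refine he.comp _ fun i j hij => ?_
    simpa [Fin.ext_iff, Subtype.ext_iff] using hij
  obtain ⟨b, hb⟩ := hv.exists_orthonormalBasis_extension_of_card_eq (by simpa using hn)
  refine ⟨b, Finset.univ.map (Fin.castLEEmb hmn), by simp, ?_⟩
  intro i hi
  obtain ⟨j, -, rfl⟩ := Finset.mem_map.1 hi
  rw [hb _ (by simp [s])]
  simp [v, e]

variable [MeasurableSpace E] [BorelSpace E]

lemma stdGaussian_apply_coordinates {ι : Type*} [Fintype ι] (b : OrthonormalBasis ι ℝ E)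
    (s : ι → Set ℝ) (hs : ∀ i, MeasurableSet (s i)) :
    stdGaussian E {x | ∀ i, ⟪b i, x⟫ ∈ s i} = ∏ i, gaussianReal 0 1 (s i) := by
  have hmeas : MeasurableSet {x : E | ∀ i, ⟪b i, x⟫ ∈ s i} := by
    rw [Set.ofPred_forall]
    exact MeasurableSet.iInter fun i => (by fun_prop : Measurable fun x : E => ⟪b i, x⟫) (hs i)
  rw [stdGaussian_eq_map_pi_orthonormalBasis b, Measure.map_apply (by fun_prop) hmeas,
    ← Measure.pi_pi]
  congr 1
  ext x
  simp [b.orthonormal.inner_right_fintype]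

lemma stdGaussian_slab_le {ι : Type*} [Fintype ι] (b : OrthonormalBasis ι ℝ E) (S : Finset ι)
    (t : ℝ) :
    stdGaussian E {x | ∀ i ∈ S, |⟪b i, x⟫| ≤ t} ≤ ENNReal.ofReal t ^ S.card := by
  classical
  have h : {x : E | ∀ i ∈ S, |⟪b i, x⟫| ≤ t} =
      {x | ∀ i, ⟪b i, x⟫ ∈ if i ∈ S then Set.Icc (-t) t else Set.univ} := by
    ext x
    refine forall_congr' fun i => ?_
    by_cases hi : i ∈ S <;> simp [hi, abs_le]
  rw [h, stdGaussian_apply_coordinates b _ fun i => by split_ifs <;> measurability]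
  calc ∏ i, gaussianReal 0 1 (if i ∈ S then Set.Icc (-t) t else Set.univ)
      ≤ ∏ i, if i ∈ S then ENNReal.ofReal t else 1 := by
        refine Finset.prod_le_prod' fun i _ => ?_
        split_ifs
        · exact gaussianReal_Icc_neg_le t
        · simp
    _ = _ := by simp [Finset.prod_ite_mem]

/-- The ball contains a cube of half-side `ε / n`, whose coordinates stay in `[-2, 2]`, where the
density is bounded below. Uniformity in `v` is needed because the centre will be the random
direction of `U`. -/
lemma exists_le_stdGaussian_closedBall (n : ℕ) (hn0 : 0 < n) (hn : Module.finrank ℝ E = n) :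
    ∃ c : ℝ, 0 < c ∧ ∀ v : E, ‖v‖ ≤ 1 → ∀ ε : ℝ, 0 ≤ ε → ε ≤ 1 →
      ENNReal.ofReal (c * ε ^ n) ≤ stdGaussian E (Metric.closedBall v ε) := by
  have hn1 : (1 : ℝ) ≤ n := by exact_mod_cast hn0
  have hp : 0 < gaussianPDFReal 0 1 2 := gaussianPDFReal_pos _ _ _ one_ne_zero
  refine ⟨(2 * gaussianPDFReal 0 1 2 / n) ^ n, by positivity, fun v hv ε hε hε1 => ?_⟩
  let b : OrthonormalBasis (Fin n) ℝ E := (stdOrthonormalBasis ℝ E).reindex (finCongr hn)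
  have hsub : {x : E | ∀ i, ⟪b i, x⟫ ∈ Set.Icc (⟪b i, v⟫ - ε / n) (⟪b i, v⟫ + ε / n)} ⊆
      Metric.closedBall v ε := by
    intro x hx
    rw [Metric.mem_closedBall, dist_eq_norm, ← b.sum_repr' (x - v)]
    calc ‖∑ i, ⟪b i, x - v⟫ • b i‖ ≤ ∑ i : Fin n, ε / n := by
          refine norm_sum_le_of_le _ fun i _ => ?_
          rw [norm_smul, b.norm_eq_one, mul_one, inner_sub_right, Real.norm_eq_abs, abs_le]
          have := hx i
          exact ⟨by linarith [this.1], by linarith [this.2]⟩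
      _ = ε := by simp; field_simp
  refine le_trans ?_ (measure_mono hsub)
  rw [stdGaussian_apply_coordinates b _ fun i => measurableSet_Icc]
  calc ENNReal.ofReal ((2 * gaussianPDFReal 0 1 2 / n) ^ n * ε ^ n)
      = ∏ _i : Fin n, ENNReal.ofReal (2 * gaussianPDFReal 0 1 2 * (ε / n)) := by
        rw [Finset.prod_const, Finset.card_univ, Fintype.card_fin, ← mul_pow,
          ENNReal.ofReal_pow (by positivity)]
        congr 2; ring
    _ ≤ _ := by
        refine Finset.prod_le_prod' fun i _ => le_gaussianReal_Icc ?_ ?_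
        · calc |⟪b i, v⟫| ≤ ‖b i‖ * ‖v‖ := abs_real_inner_le_norm _ _
            _ ≤ 1 := by rw [b.norm_eq_one, one_mul]; exact hv
        · exact (div_le_self hε hn1).trans hε1

/-- Markov's inequality for the `q`-th moment; polynomial decay of arbitrary order suffices. -/
lemma exists_stdGaussian_norm_tail_le (q : ℕ) :
    ∃ M : ℝ, 0 ≤ M ∧ ∀ R : ℝ, 0 < R →
      stdGaussian E {x | R < ‖x‖} ≤ ENNReal.ofReal (M / R ^ q) := by
  have hint : Integrable (fun x : E => ‖x‖ ^ q) (stdGaussian E) := by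
    simpa using (IsGaussian.memLp_id (stdGaussian E) q (by simp)).integrable_norm_pow'
  refine ⟨∫ x, ‖x‖ ^ q ∂(stdGaussian E), by positivity, fun R hR => ?_⟩
  have h := mul_meas_ge_le_integral_of_nonneg (μ := stdGaussian E)
    (f := fun x : E => ‖x‖ ^ q) (ae_of_all _ fun x => by positivity) hint (R ^ q)
  have h2 : (stdGaussian E).real {x | R < ‖x‖} ≤ (stdGaussian E).real {x | R ^ q ≤ ‖x‖ ^ q} := by
    refine measureReal_mono fun x hx => ?_
    have hx' : R < ‖x‖ := hx
    exact pow_le_pow_left₀ hR.le hx'.le q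
  rw [← ofReal_measureReal]
  apply ENNReal.ofReal_le_ofReal
  rw [le_div_iff₀ (by positivity), mul_comm]
  exact (mul_le_mul_of_nonneg_left h2 (by positivity)).trans h

end

/-! ### Deterministic comparison of residuals -/

section

variable {E : Type*} [NormedAddCommGroup E] [InnerProductSpace ℝ E]

lemma norm_sub_starProjection_le (K : Submodule ℝ E) [K.HasOrthogonalProjection] (y : E) {z : E} (hz : z ∈ K) :
    ‖y - K.starProjection y‖ ≤ ‖y - z‖ := by
  rw [K.starProjection_minimal]
  exact ciInf_le ⟨0, Set.forall_mem_range.2 fun _ => norm_nonneg _⟩ (⟨z, hz⟩ : K)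

/-- Up to a small error the residual is `(μ - v) + s • U`, with `s` the mismatch of noise
coefficients. A small residual forces `|s|` to be of order at least `κ / ‖U‖`, since `s • U` must
cancel `μ - v`. Pairing with `e` kills `μ - v` and leaves `s * ⟪e, U⟫`, which is then too large. -/
lemma lt_norm_sub_of_abs_inner_gt {V : Submodule ℝ E} {μ U u e v : E} {κ σ ε R a : ℝ}
    (hκ : 0 < κ) (hV : ∀ v ∈ V, κ ≤ ‖μ - v‖) (hσ : 0 < σ) (hε : 0 ≤ ε) (hε1 : ε ≤ 1)
    (hu : ‖‖U‖ • u - U‖ ≤ ε * ‖U‖) (hR : ‖U‖ ≤ R) (he : ‖e‖ = 1) (heV : ∀ v ∈ V, ⟪e, v⟫ = 0)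
    (heμ : ⟪e, μ⟫ = 0) (hU : ε * R * (8 * σ * R / κ + 1) < |⟪e, U⟫|) (hv : v ∈ V) :
    σ * (ε * ‖U‖) < ‖μ + σ • U - (v + a • u)‖ := by
  by_contra! hcon
  have hR0 : 0 ≤ R := (norm_nonneg U).trans hR
  have hU' : ε * ‖U‖ * (8 * σ * ‖U‖ / κ + 1) < |⟪e, U⟫| := lt_of_le_of_lt (by gcongr) hU
  have hr : 0 < ‖U‖ := by
    rw [norm_pos_iff]
    rintro rfl
    simp at hU'
  set r := ‖U‖ with hr_def
  have hle : |⟪e, U⟫| ≤ r := by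
    have := abs_real_inner_le_norm e U
    rwa [he, one_mul] at this
  set w := r • u - U with hw
  set b := a / r with hb
  set s := σ - b with hs
  have hau : a • u = b • U + b • w := by
    rw [hw, smul_sub, smul_smul, hb, div_mul_cancel₀ _ hr.ne']
    abel
  have hz : μ + σ • U - (v + a • u) = (μ - v) + s • U - b • w := by
    rw [hau, hs, sub_smul]; abel
  rw [hz] at hcon
  have hbs : |b| ≤ σ + |s| := by
    have : b = σ - s := by rw [hs]; ring
    rw [this]
    exact (abs_sub _ _).trans (by rw [abs_of_pos hσ])
  have hbw : ‖b • w‖ ≤ (σ + |s|) * (ε * r) := by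
    rw [norm_smul, Real.norm_eq_abs]
    gcongr
  have h1 : |s| * |⟪e, U⟫| ≤ ε * r * (2 * σ + |s|) := by
    have h2 : ⟪e, (μ - v) + s • U - b • w⟫ = s * ⟪e, U⟫ - ⟪e, b • w⟫ := by
      rw [inner_sub_right, inner_add_right, inner_sub_right, heμ, heV v hv, real_inner_smul_right]
      ring
    have h3 : |s * ⟪e, U⟫ - ⟪e, b • w⟫| ≤ σ * (ε * r) := by
      rw [← h2]
      refine (abs_real_inner_le_norm _ _).trans ?_
      rwa [he, one_mul]
    have h4 : |⟪e, b • w⟫| ≤ (σ + |s|) * (ε * r) := by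
      refine (abs_real_inner_le_norm _ _).trans ?_
      rwa [he, one_mul]
    have h5 := abs_sub_abs_le_abs_sub (s * ⟪e, U⟫) ⟪e, b • w⟫
    rw [abs_mul] at h5
    linarith
  have h2 : κ ≤ |s| * r + ε * r * (2 * σ + |s|) := by
    have h3 : ‖μ - v‖ ≤ ‖(μ - v) + s • U - b • w‖ + ‖b • w‖ + ‖s • U‖ := by
      have : μ - v = ((μ - v) + s • U - b • w) + b • w - s • U := by abel
      calc ‖μ - v‖ = ‖((μ - v) + s • U - b • w) + b • w - s • U‖ := by rw [← this]
        _ ≤ _ := (norm_sub_le _ _).trans (by gcongr; exact norm_add_le _ _)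
    have h4 : ‖s • U‖ = |s| * r := by rw [norm_smul, Real.norm_eq_abs]
    have := hV v hv
    linarith
  have hεr : 0 ≤ ε * r := by positivity
  -- Otherwise the threshold in `hU'` would be at least `‖U‖`, hence at least `|⟪e, U⟫|`.
  have hsmall : 4 * σ * (ε * r) ≤ κ := by
    by_contra! hbig
    have : r ≤ ε * r * (8 * σ * r / κ + 1) := by
      have h3 : 1 ≤ 4 * σ * (ε * r) / κ := by rw [le_div_iff₀ hκ]; linarith
      have h4 : ε * r * (8 * σ * r / κ + 1) = 2 * r * (4 * σ * (ε * r) / κ) + ε * r := by ring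
      rw [h4]
      nlinarith
    linarith
  have hs_lower : κ ≤ 4 * (|s| * r) := by
    have : ε * r * |s| ≤ |s| * r := by nlinarith [mul_nonneg (abs_nonneg s) hr.le]
    nlinarith
  have hs0 : 0 < |s| := by
    by_contra! h
    have : |s| * r ≤ 0 := mul_nonpos_of_nonpos_of_nonneg h hr.le
    linarith
  have h3 : |s| * (ε * r * (8 * σ * r / κ + 1)) < |s| * |⟪e, U⟫| := mul_lt_mul_of_pos_left hU' hs0
  have h4 : 2 * σ ≤ |s| * (8 * σ * r / κ) := by
    have : |s| * (8 * σ * r / κ) = (2 * σ * (4 * (|s| * r))) / κ := by ring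
    rw [this, le_div_iff₀ hκ]
    gcongr
  have h5 : ε * r * (2 * σ + |s|) ≤ |s| * (ε * r * (8 * σ * r / κ + 1)) := by
    calc ε * r * (2 * σ + |s|) ≤ ε * r * (|s| * (8 * σ * r / κ) + |s|) := by gcongr
      _ = _ := by ring
  linarith

lemma norm_sub_starProjection_lt [FiniteDimensional ℝ E] {V V₀ : Submodule ℝ E} {μ U u e : E} {κ σ ε R : ℝ}
    (hμ : μ ∈ V₀) (hκ : 0 < κ) (hV : ∀ v ∈ V, κ ≤ ‖μ - v‖) (hσ : 0 < σ) (hε : 0 ≤ ε) (hε1 : ε ≤ 1)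
    (hu : ‖‖U‖ • u - U‖ ≤ ε * ‖U‖) (hR : ‖U‖ ≤ R) (he : ‖e‖ = 1) (heV : ∀ v ∈ V, ⟪e, v⟫ = 0)
    (heμ : ⟪e, μ⟫ = 0) (hU : ε * R * (8 * σ * R / κ + 1) < |⟪e, U⟫|) :
    ‖(μ + σ • U) - (V₀ ⊔ ℝ ∙ u).starProjection (μ + σ • U)‖ <
      ‖(μ + σ • U) - (V ⊔ ℝ ∙ u).starProjection (μ + σ • U)‖ := by
  obtain ⟨v, hv, z, hz, hvz⟩ := Submodule.mem_sup.1
    ((V ⊔ ℝ ∙ u).starProjection_apply_mem (μ + σ • U))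
  obtain ⟨a, rfl⟩ := Submodule.mem_span_singleton.1 hz
  rw [← hvz]
  refine lt_of_le_of_lt ?_
    (lt_norm_sub_of_abs_inner_gt hκ hV hσ hε hε1 hu hR he heV heμ hU hv)
  have hmem : μ + (σ * ‖U‖) • u ∈ V₀ ⊔ ℝ ∙ u :=
    Submodule.add_mem_sup hμ (Submodule.smul_mem _ _ (Submodule.mem_span_singleton_self u))
  refine (norm_sub_starProjection_le _ _ hmem).trans ?_
  have : μ + σ • U - (μ + (σ * ‖U‖) • u) = -(σ • (‖U‖ • u - U)) := by
    rw [smul_sub, smul_smul]; abel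
  rw [this, norm_neg, norm_smul, Real.norm_eq_abs, abs_of_pos hσ]
  gcongr

end

/-! ### Column spaces and the separation constant -/

namespace PermReg

section

variable {n p : ℕ}

lemma toLp_mulVec_mem_colSpace {ι : Type*} [Fintype ι] (A : Matrix (Fin n) ι ℝ) (b : ι → ℝ) :
    WithLp.toLp 2 (A.mulVec b) ∈ colSpace A := by
  have h : WithLp.toLp 2 (A.mulVec b) = ∑ j, b j • WithLp.toLp 2 (fun i => A i j) := by
    ext i
    simp [Matrix.mulVec, dotProduct, mul_comm]
  rw [h]
  exact Submodule.sum_mem _ fun j _ =>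
    Submodule.smul_mem _ _ (Submodule.subset_span ⟨j, rfl⟩)

lemma exists_mulVec_of_mem_colSpace {ι : Type*} [Fintype ι] {A : Matrix (Fin n) ι ℝ}
    {x : EuclideanSpace ℝ (Fin n)} (hx : x ∈ colSpace A) :
    ∃ b : ι → ℝ, x = WithLp.toLp 2 (A.mulVec b) := by
  obtain ⟨b, rfl⟩ := (Submodule.mem_span_range_iff_exists_fun ℝ).1 hx
  refine ⟨b, ?_⟩
  ext i
  simp [Matrix.mulVec, dotProduct, mul_comm]

lemma finrank_colSpace_le {ι : Type*} [Fintype ι] (A : Matrix (Fin n) ι ℝ) :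
    Module.finrank ℝ (colSpace A) ≤ Fintype.card ι :=
  finrank_range_le_card _

lemma colSpace_augDesign (X : Matrix (Fin n) (Fin p) ℝ) (u : EuclideanSpace ℝ (Fin n))
    (Q : Matrix (Fin n) (Fin n) ℝ) :
    colSpace (augDesign X u Q) = colSpace (Q * X) ⊔ ℝ ∙ u := by
  rw [colSpace, colSpace, ← Submodule.span_union]
  congr 1
  ext x
  simp only [Set.mem_range, Sum.exists, Set.mem_union, Set.mem_singleton_iff, augDesign,
    Matrix.fromCols_apply_inl, Matrix.fromCols_apply_inr, Matrix.replicateCol_apply]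
  simp [eq_comm]

lemma isUnit_det_transpose_mul_self {X : Matrix (Fin n) (Fin p) ℝ} (hX : X.rank = p) :
    IsUnit (X.transpose * X).det := by
  have hrank : (X.transpose * X).rank = p := by rw [Matrix.rank_transpose_mul_self, hX]
  rw [← Matrix.isUnit_iff_isUnit_det, ← Matrix.mulVec_surjective_iff_isUnit]
  exact LinearMap.range_eq_top.1 (Submodule.eq_top_of_finrank_eq
    (hrank.trans (Module.finrank_fin_fun ℝ).symm))

lemma sepRatio_eq_zero {X : Matrix (Fin n) (Fin p) ℝ} (hX : X.rank = p) {β₀ : Fin p → ℝ}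
    {Q₀ Q : Matrix (Fin n) (Fin n) ℝ} (hQ : Q.transpose * Q = 1)
    (hmem : WithLp.toLp 2 ((Q₀ * X).mulVec β₀) ∈ colSpace (Q * X)) :
    sepRatio X β₀ Q₀ Q = 0 := by
  obtain ⟨b, hb⟩ := exists_mulVec_of_mem_colSpace hmem
  have hb' : (Q₀ * X).mulVec β₀ = (Q * X).mulVec b := WithLp.toLp_injective 2 hb
  have hM : Q * hatMatrix X * Q.transpose * (Q * X) = Q * X := by
    have h1 : Q * hatMatrix X * Q.transpose * (Q * X) =
        Q * hatMatrix X * (Q.transpose * Q) * X := by simp only [Matrix.mul_assoc]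
    have h2 : Q * hatMatrix X * X = Q * X * ((X.transpose * X)⁻¹ * (X.transpose * X)) := by
      simp only [hatMatrix, Matrix.mul_assoc]
    rw [h1, hQ, Matrix.mul_one, h2, Matrix.nonsing_inv_mul _ (isUnit_det_transpose_mul_self hX),
      Matrix.mul_one]
  rw [sepRatio, hb', Matrix.mulVec_mulVec, Matrix.sub_mul, hM]
  simp

lemma transpose_mul_self_of_mem_sparsePerms {k : ℕ} {Q : Matrix (Fin n) (Fin n) ℝ}
    (hQ : Q ∈ sparsePerms n k) : Q.transpose * Q = 1 := by
  obtain ⟨⟨τ, rfl⟩, -⟩ := hQ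
  rw [Matrix.transpose_permMatrix, ← Matrix.permMatrix_mul]
  simp

lemma finite_sparsePerms (n k : ℕ) : (sparsePerms n k).Finite :=
  (Set.finite_range fun τ : Equiv.Perm (Fin n) => τ.permMatrix ℝ).subset
    fun _ ⟨⟨τ, h⟩, _⟩ => ⟨τ, h.symm⟩

/-- The only use made of the separation constant: its positivity, not its size. -/
lemma notMem_colSpace_of_Cmin_pos {k : ℕ} {X : Matrix (Fin n) (Fin p) ℝ} (hX : X.rank = p)
    {β₀ : Fin p → ℝ} {Q₀ Q : Matrix (Fin n) (Fin n) ℝ} (hC : 0 < Cmin k X β₀ Q₀)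
    (hQ : Q ∈ sparsePerms n k) (hne : Q ≠ Q₀) :
    WithLp.toLp 2 ((Q₀ * X).mulVec β₀) ∉ colSpace (Q * X) := by
  intro hmem
  have h : Cmin k X β₀ Q₀ ≤ ((sepRatio X β₀ Q₀ Q : ℝ) : EReal) := iInf₂_le Q ⟨hQ, hne⟩
  rw [sepRatio_eq_zero hX (transpose_mul_self_of_mem_sparsePerms hQ) hmem] at h
  exact absurd (hC.trans_le h) (by simp)

end

end PermReg

/-! ### Probability of failure for fixed `ε` and `R` -/

namespace PermReg

section

variable {n p k : ℕ} {X : Matrix (Fin n) (Fin p) ℝ} {β₀ : Fin p → ℝ} {σ₀ : ℝ}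
  {Q₀ : Matrix (Fin n) (Fin n) ℝ}

lemma exists_separation {Q : Matrix (Fin n) (Fin n) ℝ} {μ : EuclideanSpace ℝ (Fin n)}
    (hμ : μ ∉ colSpace (Q * X)) :
    ∃ κ : ℝ, 0 < κ ∧ (∀ v ∈ colSpace (Q * X), κ ≤ ‖μ - v‖) ∧
      ∃ b : OrthonormalBasis (Fin n) ℝ (EuclideanSpace ℝ (Fin n)), ∃ S : Finset (Fin n),
        S.card = n - p - 1 ∧ ∀ i ∈ S, (∀ v ∈ colSpace (Q * X), ⟪b i, v⟫ = 0) ∧ ⟪b i, μ⟫ = 0 := by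
  set V := colSpace (Q * X) with hV
  refine ⟨‖μ - V.starProjection μ‖, ?_, fun v hv => norm_sub_starProjection_le V μ hv, ?_⟩
  · rw [norm_pos_iff, sub_ne_zero]
    exact fun h => hμ (h ▸ V.starProjection_apply_mem μ)
  have hrank : n - p - 1 ≤ Module.finrank ℝ ((V ⊔ ℝ ∙ μ)ᗮ : Submodule ℝ _) := by
    have h1 := Submodule.finrank_add_finrank_orthogonal (V ⊔ ℝ ∙ μ)
    have h2 := Submodule.finrank_add_le_finrank_add_finrank V (ℝ ∙ μ)
    have h3 : Module.finrank ℝ V ≤ p := by simpa using finrank_colSpace_le (Q * X)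
    have h4 : Module.finrank ℝ (ℝ ∙ μ) ≤ 1 := by
      simpa using finrank_span_le_card ({μ} : Set (EuclideanSpace ℝ (Fin n)))
    rw [finrank_euclideanSpace_fin] at h1
    omega
  obtain ⟨b, S, hS, hb⟩ :=
    exists_orthonormalBasis_mem_submodule _ (finrank_euclideanSpace_fin (𝕜 := ℝ) (n := n)) hrank
  refine ⟨b, S, hS, fun i hi => ⟨fun v hv => ?_, ?_⟩⟩
  · exact Submodule.inner_left_of_mem_orthogonal (Submodule.mem_sup_left hv) (hb i hi)
  · exact Submodule.inner_left_of_mem_orthogonal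
      (Submodule.mem_sup_right (Submodule.mem_span_singleton_self μ)) (hb i hi)

lemma objective_eq (y u : EuclideanSpace ℝ (Fin n)) (Q : Matrix (Fin n) (Fin n) ℝ) :
    objective X y u Q = ‖y - (colSpace (Q * X) ⊔ ℝ ∙ u).starProjection y‖ ^ 2 := by
  simp only [objective, colSpace_augDesign]

/-- `A` is the slab where all the good coordinates of `U` are below the threshold. It does not
depend on `u`, so no union over the artificial noises is needed. -/
lemma exists_objective_lt (hσ₀ : 0 < σ₀) {Q : Matrix (Fin n) (Fin n) ℝ}
    (hμ : WithLp.toLp 2 ((Q₀ * X).mulVec β₀) ∉ colSpace (Q * X)) :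
    ∃ C : ℝ, 0 ≤ C ∧ ∀ ε R : ℝ, 0 ≤ ε → ε ≤ 1 → 1 ≤ R →
      ∃ A : Set (EuclideanSpace ℝ (Fin n)),
        stdGaussian _ A ≤ ENNReal.ofReal (C * (ε * R ^ 2) ^ (n - p - 1)) ∧
        ∀ U ∉ A, ‖U‖ ≤ R → ∀ u, ‖‖U‖ • u - U‖ ≤ ε * ‖U‖ →
          objective X (response X β₀ σ₀ Q₀ U) u Q₀ < objective X (response X β₀ σ₀ Q₀ U) u Q := by
  obtain ⟨κ, hκ, hdist, b, S, hS, hb⟩ := exists_separation hμ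
  refine ⟨(8 * σ₀ / κ + 1) ^ (n - p - 1), by positivity, fun ε R hε hε1 hR => ?_⟩
  have hR0 : 0 ≤ R := zero_le_one.trans hR
  set t := ε * R * (8 * σ₀ * R / κ + 1) with ht_def
  have ht : t ≤ (8 * σ₀ / κ + 1) * (ε * R ^ 2) := by
    calc ε * R * (8 * σ₀ * R / κ + 1) ≤ ε * R * (8 * σ₀ * R / κ + R) := by gcongr
      _ = _ := by ring
  refine ⟨{U | ∀ i ∈ S, |⟪b i, U⟫| ≤ t}, ?_, ?_⟩
  · refine (stdGaussian_slab_le b S t).trans ?_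
    rw [hS, ← mul_pow, ← ENNReal.ofReal_pow (by positivity)]
    exact ENNReal.ofReal_le_ofReal (by gcongr)
  · intro U hU hUR u hu
    simp only [Set.mem_ofPred_eq, not_forall, not_le] at hU
    obtain ⟨i, hi, hti⟩ := hU
    rw [objective_eq, objective_eq]
    refine pow_lt_pow_left₀ ?_ (norm_nonneg _) two_ne_zero
    exact norm_sub_starProjection_lt (toLp_mulVec_mem_colSpace _ _) hκ hdist hσ₀ hε hε1 hu hUR
      (b.norm_eq_one i) (hb i hi).1 (hb i hi).2 hti

/-- Conditionally on `U` the `L` misses are independent, each of probability at most `1 - cεⁿ`. -/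
lemma jointLaw_forall_notMem_closedBall_le (hn : 0 < n) :
    ∃ c : ℝ, 0 < c ∧ ∀ (L : ℕ) (ε : ℝ), 0 ≤ ε → ε ≤ 1 →
      jointLaw n L {ω | ∀ ℓ, ω.1 ℓ ∉ Metric.closedBall (‖ω.2‖⁻¹ • ω.2) ε} ≤
        ENNReal.ofReal (Real.exp (-(c * ε ^ n * L))) := by
  obtain ⟨c, hc, hball⟩ := exists_le_stdGaussian_closedBall (E := EuclideanSpace ℝ (Fin n)) n hn
    finrank_euclideanSpace_fin
  refine ⟨c, hc, fun L ε hε hε1 => ?_⟩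
  have hmeas : MeasurableSet
      {ω : Sample n L | ∀ ℓ, ω.1 ℓ ∉ Metric.closedBall (‖ω.2‖⁻¹ • ω.2) ε} := by
    simp only [Metric.mem_closedBall, not_le]
    rw [Set.ofPred_forall]
    exact MeasurableSet.iInter fun ℓ => measurableSet_lt (by fun_prop) (by fun_prop)
  rw [jointLaw, Measure.prod_apply_symm hmeas]
  refine (lintegral_mono (g := fun _ => ENNReal.ofReal (Real.exp (-(c * ε ^ n * L)))) ?_).trans
    (by simp)
  intro U
  beta_reduce
  set v := ‖U‖⁻¹ • U with hv
  -- Only an inequality: for `U = 0` the centre is `0`.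
  have hv1 : ‖v‖ ≤ 1 := by
    rw [hv, norm_smul, norm_inv, norm_norm]
    exact inv_mul_le_one
  have hset : (fun f : Fin L → EuclideanSpace ℝ (Fin n) => (f, U)) ⁻¹'
      {ω : Sample n L | ∀ ℓ, ω.1 ℓ ∉ Metric.closedBall (‖ω.2‖⁻¹ • ω.2) ε} =
      Set.univ.pi fun _ => (Metric.closedBall v ε)ᶜ := by
    ext f
    simp [hv]
  have hone : stdGaussian _ (Metric.closedBall v ε)ᶜ ≤
      ENNReal.ofReal (Real.exp (-(c * ε ^ n))) := by
    rw [prob_compl_eq_one_sub measurableSet_closedBall]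
    calc 1 - stdGaussian _ (Metric.closedBall v ε)
        ≤ ENNReal.ofReal 1 - ENNReal.ofReal (c * ε ^ n) := by
          rw [ENNReal.ofReal_one]
          exact tsub_le_tsub_left (hball v hv1 ε hε hε1) 1
      _ = ENNReal.ofReal (1 - c * ε ^ n) := (ENNReal.ofReal_sub _ (by positivity)).symm
      _ ≤ _ := ENNReal.ofReal_le_ofReal (Real.one_sub_le_exp_neg _)
  calc _ = stdGaussian _ (Metric.closedBall v ε)ᶜ ^ L := by
        rw [hset, Measure.pi_pi, Finset.prod_const, Finset.card_univ, Fintype.card_fin]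
    _ ≤ ENNReal.ofReal (Real.exp (-(c * ε ^ n))) ^ L := by gcongr
    _ = _ := by
        rw [← ENNReal.ofReal_pow (Real.exp_pos _).le, ← Real.exp_nat_mul]
        congr 2; ring

lemma exists_jointLaw_notMem_candidateSet_le (hX : X.rank = p) (hσ₀ : 0 < σ₀)
    (hC : 0 < Cmin k X β₀ Q₀) (hn : 0 < n) (q : ℕ) :
    ∃ M C c : ℝ, 0 ≤ M ∧ 0 ≤ C ∧ 0 < c ∧ ∀ (L : ℕ) (ε R : ℝ), 0 ≤ ε → ε ≤ 1 → 1 ≤ R →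
      Q₀ ∈ sparsePerms n k →
      ∀ Qhat : Sample n L → Fin L → Matrix (Fin n) (Fin n) ℝ,
        IsReproEstimator k X β₀ σ₀ Q₀ Qhat →
        (jointLaw n L).real {ω | Q₀ ∉ candidateSet Qhat ω} ≤
          M / R ^ q + C * (ε * R ^ 2) ^ (n - p - 1) + Real.exp (-(c * ε ^ n * L)) := by
  classical
  obtain ⟨M, hM, htail⟩ := exists_stdGaussian_norm_tail_le (E := EuclideanSpace ℝ (Fin n)) q
  obtain ⟨c, hc, hmiss⟩ := jointLaw_forall_notMem_closedBall_le hn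
  have hsep : ∀ Q : {Q // Q ∈ sparsePerms n k ∧ Q ≠ Q₀}, _ := fun Q =>
    exists_objective_lt hσ₀ (notMem_colSpace_of_Cmin_pos hX hC Q.2.1 Q.2.2)
  choose C hC0 hA using hsep
  have : Finite {Q // Q ∈ sparsePerms n k ∧ Q ≠ Q₀} :=
    ((finite_sparsePerms n k).subset fun Q hQ => hQ.1).to_subtype
  have := Fintype.ofFinite {Q // Q ∈ sparsePerms n k ∧ Q ≠ Q₀}
  refine ⟨M, ∑ Q, C Q, c, hM, Finset.sum_nonneg fun Q _ => hC0 Q, hc, ?_⟩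
  intro L ε R hε hε1 hR hQ₀ Qhat hQhat
  have hR0 : 0 < R := zero_lt_one.trans_le hR
  choose A hAmeas hAobj using fun Q => hA Q ε R hε hε1 hR
  -- Arbitrary tie-breaking may make the left side non-measurable; monotonicity of the outer measure
  -- is enough.
  have hsub : {ω | Q₀ ∉ candidateSet Qhat ω} ⊆
      (Set.univ ×ˢ {U | R < ‖U‖} ∪ ⋃ Q, Set.univ ×ˢ A Q) ∪
        {ω | ∀ ℓ, ω.1 ℓ ∉ Metric.closedBall (‖ω.2‖⁻¹ • ω.2) ε} := by
    intro ω hω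
    by_contra hgood
    simp only [Set.mem_union, Set.mem_prod, Set.mem_univ, true_and, Set.mem_ofPred_eq,
      Set.mem_iUnion, not_or, not_exists, not_lt, not_forall, not_not] at hgood
    obtain ⟨⟨hUR, hUA⟩, ℓ, hℓ⟩ := hgood
    refine hω ⟨ℓ, ?_⟩
    by_contra hne
    have hmin := hQhat ω ℓ
    have hu : ‖‖ω.2‖ • ω.1 ℓ - ω.2‖ ≤ ε * ‖ω.2‖ := by
      by_cases h0 : ω.2 = 0
      · simp [h0]
      have h0' : ‖ω.2‖ ≠ 0 := norm_ne_zero_iff.2 h0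
      have : ‖ω.2‖ • ω.1 ℓ - ω.2 = ‖ω.2‖ • (ω.1 ℓ - ‖ω.2‖⁻¹ • ω.2) := by
        rw [smul_sub, smul_smul, mul_inv_cancel₀ h0', one_smul]
      rw [this, norm_smul, norm_norm, mul_comm]
      gcongr
      rwa [Metric.mem_closedBall, dist_eq_norm] at hℓ
    exact absurd (hmin.2 Q₀ hQ₀)
      (not_le.2 (hAobj ⟨Qhat ω ℓ, hmin.1, hne⟩ ω.2 (hUA _) hUR (ω.1 ℓ) hu))
  have hprod : ∀ B : Set (EuclideanSpace ℝ (Fin n)),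
      jointLaw n L (Set.univ ×ˢ B) = stdGaussian _ B := by
    intro B
    rw [jointLaw, Measure.prod_prod, measure_univ, one_mul]
  have hfin : jointLaw n L {ω | Q₀ ∉ candidateSet Qhat ω} ≤
      ENNReal.ofReal (M / R ^ q + (∑ Q, C Q) * (ε * R ^ 2) ^ (n - p - 1) +
        Real.exp (-(c * ε ^ n * L))) := by
    have hsum : 0 ≤ ∑ Q, C Q := Finset.sum_nonneg fun Q _ => hC0 Q
    rw [ENNReal.ofReal_add (by positivity) (by positivity),
      ENNReal.ofReal_add (by positivity) (by positivity), Finset.sum_mul,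
      ENNReal.ofReal_sum_of_nonneg fun Q _ => mul_nonneg (hC0 Q) (by positivity)]
    refine (measure_mono hsub).trans ((measure_union_le _ _).trans ?_)
    refine add_le_add ((measure_union_le _ _).trans (add_le_add ?_ ?_)) (hmiss L ε hε hε1)
    · rw [hprod]; exact htail R hR0
    · refine (measure_iUnion_fintype_le _ _).trans (Finset.sum_le_sum fun Q _ => ?_)
      rw [hprod]; exact hAmeas Q
  exact ENNReal.toReal_le_of_le_ofReal
    (add_nonneg (add_nonneg (by positivity)
      (mul_nonneg (Finset.sum_nonneg fun Q _ => hC0 Q) (by positivity))) (Real.exp_pos _).le) hfin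

end

end PermReg

/-! ### Choice of rates and conclusion -/

lemma exp_neg_mul_rpow_le {c η s : ℝ} (hc : 0 < c) (hη : 0 < η) :
    ∃ K : ℝ, 0 ≤ K ∧ ∀ x : ℝ, 1 ≤ x → Real.exp (-(c * x ^ η)) ≤ K * x ^ (-s) := by
  obtain ⟨j, hj⟩ := exists_nat_ge (s / η)
  refine ⟨(j.factorial : ℝ) / c ^ j, by positivity, fun x hx => ?_⟩
  have hx0 : 0 < x := zero_lt_one.trans_le hx
  have hy : 0 < c * x ^ η := by positivity
  have h1 := Real.pow_div_factorial_le_exp (c * x ^ η) hy.le j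
  have h2 : x ^ s ≤ (x ^ η) ^ j := by
    rw [← Real.rpow_natCast, ← Real.rpow_mul hx0.le]
    apply Real.rpow_le_rpow_of_exponent_le hx
    rw [div_le_iff₀ hη] at hj
    linarith
  rw [Real.exp_neg, Real.rpow_neg hx0.le, ← div_eq_mul_inv, div_div]
  have h3 : c ^ j * x ^ s / j.factorial ≤ Real.exp (c * x ^ η) :=
    le_trans (by rw [mul_pow]; gcongr) h1
  calc (Real.exp (c * x ^ η))⁻¹ ≤ (c ^ j * x ^ s / j.factorial)⁻¹ :=
        inv_anti₀ (by positivity) h3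
    _ = _ := by rw [inv_div]

lemma isBigO_max_rpow_neg {a s K : ℝ} (ha : 0 ≤ a) :
    (fun L : ℕ => K * (max (L : ℝ) 1) ^ (-s)) =O[atTop]
      fun L : ℕ => Real.log (L : ℝ) ^ a / (L : ℝ) ^ s := by
  refine IsBigO.of_bound |K| ?_
  filter_upwards [eventually_ge_atTop 3] with L hL
  have hL3 : (3 : ℝ) ≤ L := by exact_mod_cast hL
  have hlog : 1 ≤ Real.log L := by
    rw [Real.le_log_iff_exp_le (by linarith)]
    exact Real.exp_one_lt_d9.le.trans (by linarith)
  have hpow : 1 ≤ Real.log L ^ a := Real.one_le_rpow hlog ha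
  have hs : 0 < (L : ℝ) ^ s := by positivity
  rw [max_eq_left (by linarith), Real.rpow_neg (by linarith), norm_mul, Real.norm_eq_abs,
    Real.norm_of_nonneg (by positivity), Real.norm_of_nonneg (by positivity), inv_eq_one_div]
  gcongr

theorem theorem1 (n p k : ℕ) (X : Matrix (Fin n) (Fin p) ℝ) (hX : X.rank = p)
    (β₀ : Fin p → ℝ) (σ₀ : ℝ) (hσ₀ : 0 < σ₀)
    (Q₀ : Matrix (Fin n) (Fin n) ℝ) (hQ₀ : Q₀ ∈ PermReg.sparsePerms n k)
    (hC : 0 < PermReg.Cmin k X β₀ Q₀) (hn : p + 1 < n) :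
    ∃ δ : ℕ → ℝ, (∀ L, 0 < δ L) ∧
      (∀ L, 2 ≤ L →
        ∀ Qhat : PermReg.Sample n L → Fin L → Matrix (Fin n) (Fin n) ℝ,
          PermReg.IsReproEstimator k X β₀ σ₀ Q₀ Qhat →
          (PermReg.jointLaw n L).real {ω | Q₀ ∉ PermReg.candidateSet Qhat ω} ≤ δ L) ∧
      δ =O[atTop] fun L : ℕ =>
        (Real.log (L : ℝ)) ^ (((n : ℝ) - (p : ℝ)) / 2) /
          (L : ℝ) ^ (((n : ℝ) - (p : ℝ) - 1) / (2 * ((n : ℝ) - 1))) := by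
  have hnp : (p : ℝ) + 1 < n := by exact_mod_cast hn
  have hp0 : (0 : ℝ) ≤ p := p.cast_nonneg
  set s := ((n : ℝ) - (p : ℝ) - 1) / (2 * ((n : ℝ) - 1)) with hs
  suffices h : ∃ K : ℝ, 0 ≤ K ∧ ∀ L, 1 ≤ L →
      ∀ Qhat : PermReg.Sample n L → Fin L → Matrix (Fin n) (Fin n) ℝ,
        PermReg.IsReproEstimator k X β₀ σ₀ Q₀ Qhat →
        (PermReg.jointLaw n L).real {ω | Q₀ ∉ PermReg.candidateSet Qhat ω} ≤
          K * (L : ℝ) ^ (-s) by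
    obtain ⟨K, hK, hbound⟩ := h
    -- `K + 1` and the maximum keep `δ` positive even if `K = 0` or `L = 0`.
    refine ⟨fun L => (K + 1) * (max (L : ℝ) 1) ^ (-s), fun L => by positivity, ?_,
      isBigO_max_rpow_neg (by linarith)⟩
    intro L hL Qhat hQhat
    have hL1 : (1 : ℝ) ≤ L := by exact_mod_cast one_le_two.trans hL
    refine (hbound L (one_le_two.trans hL) Qhat hQhat).trans ?_
    beta_reduce
    rw [max_eq_left hL1]
    gcongr
    linarith
  by_cases hex : ∃ Q ∈ PermReg.sparsePerms n k, Q ≠ Q₀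
  swap
  · push Not at hex
    refine ⟨0, le_rfl, fun L hL Qhat hQhat => ?_⟩
    have : {ω | Q₀ ∉ PermReg.candidateSet Qhat ω} = ∅ := by
      rw [Set.eq_empty_iff_forall_notMem]
      exact fun ω hω => hω ⟨⟨0, hL⟩, hex _ (hQhat ω ⟨0, hL⟩).1⟩
    simp [this]
  obtain ⟨Q, hQ, hne⟩ := hex
  -- For `p = 0` the signal is `0`, which lies in every column space, so no rival could exist. Hence
  -- `n > 2`, which is what gives `d < 1 / n` below.
  have hp : 1 ≤ p := by
    by_contra! hp
    obtain rfl : p = 0 := by omega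
    refine PermReg.notMem_colSpace_of_Cmin_pos hX hC hQ hne ?_
    rw [Subsingleton.elim β₀ 0, Matrix.mulVec_zero]
    exact Submodule.zero_mem _
  have hp1 : (1 : ℝ) ≤ p := by exact_mod_cast hp
  have hn3 : (2 : ℝ) < n := by linarith
  set d := 1 / (2 * ((n : ℝ) - 1)) with hd
  have hdn : d < 1 / n := one_div_lt_one_div_of_lt (by linarith) (by linarith)
  have hd0 : 0 < d := one_div_pos.2 (by linarith)
  -- With `ε = L^(-a)`, `R = L^b`: `a < 1 / n` makes `εⁿL` a positive power of `L`; `a > d` leaves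
  -- room for `b > 0` with `εR² = L^(-d)`.
  set a := (1 / (n : ℝ) + d) / 2 with ha
  set b := (a - d) / 2 with hb
  have hb0 : 0 < b := by rw [hb, ha]; linarith
  have ha0 : 0 < a := by rw [ha]; positivity
  have han : 0 < 1 - a * n := by
    have : a < 1 / n := by rw [ha]; linarith
    rw [lt_div_iff₀ (by linarith)] at this
    linarith
  -- Enough moments that `R^(-q) ≤ L^(-s)`, however small `b` is.
  obtain ⟨q, hq⟩ := exists_nat_ge (s / b)
  obtain ⟨M, C, c, hM, hC0, hc, hbound⟩ :=
    PermReg.exists_jointLaw_notMem_candidateSet_le (k := k) hX hσ₀ hC (by omega) q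
  obtain ⟨K, hK, hexp⟩ := exp_neg_mul_rpow_le (s := s) hc han
  refine ⟨M + C + K, by positivity, fun L hL Qhat hQhat => ?_⟩
  have hL1 : (1 : ℝ) ≤ L := by exact_mod_cast hL
  have hL0 : (0 : ℝ) < L := by linarith
  refine (hbound L ((L : ℝ) ^ (-a)) ((L : ℝ) ^ b) (by positivity)
    (Real.rpow_le_one_of_one_le_of_nonpos hL1 (by linarith)) (Real.one_le_rpow hL1 hb0.le)
    hQ₀ Qhat hQhat).trans ?_
  have h1 : M / ((L : ℝ) ^ b) ^ q ≤ M * (L : ℝ) ^ (-s) := by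
    rw [Real.rpow_neg hL0.le, ← div_eq_mul_inv, ← Real.rpow_natCast, ← Real.rpow_mul hL0.le]
    rw [div_le_iff₀ hb0] at hq
    gcongr
    linarith
  have h2 : ((L : ℝ) ^ (-a) * ((L : ℝ) ^ b) ^ 2) ^ (n - p - 1) = (L : ℝ) ^ (-s) := by
    rw [← Real.rpow_natCast, ← Real.rpow_natCast, ← Real.rpow_mul hL0.le, ← Real.rpow_add hL0,
      ← Real.rpow_mul hL0.le]
    congr 1
    have hm : ((n - p - 1 : ℕ) : ℝ) = (n : ℝ) - p - 1 := by
      rw [Nat.cast_sub (by omega), Nat.cast_sub (by omega)]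
      simp
    rw [hm, hs, hb, hd]
    push_cast
    ring
  have h3 : Real.exp (-(c * ((L : ℝ) ^ (-a)) ^ n * L)) ≤ K * (L : ℝ) ^ (-s) := by
    refine le_of_eq_of_le ?_ (hexp L hL1)
    rw [← Real.rpow_natCast, ← Real.rpow_mul hL0.le, mul_assoc, ← Real.rpow_add_one hL0.ne']
    congr 4
    ring
  rw [h2]
  linarith
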